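/- **Setting.** Let $\mu$ be a probability distribution on a measurable space $(E,\mathscr E)$. For a Markov kernel $P$ write $Pf(z)=\int f(z')\,P(z,\mathrm dz')$, and $\langle f,g\rangle_\mu=\int fg\,\mathrm d\mu$. Let $\xi\colon E\to E$ be a measurable involution such that $Qf:=f\circ\xi$ is an isometric involution of $L^2(\mu)$, i.e. $\langle Qf,Qg\rangle_\mu=\langle f,g\rangle_\mu$ for $f,g\in L^2(\mu)$ and $Q^2=\mathrm{Id}$. A Markov kernel $P$ is called $(\mu,Q)$-reversible if $\langle Pf,g\rangle_\mu=\langle f,QPQg\rangle_\mu$ for all $f,g\in L^2(\mu)$. For $\lambda\in[0,1)$, $f\in L^2(\mu)$, $\bar f=f-\mu(f)$ and two $\mu$-invariant Markov kernels $P_1,P_2$ let $$\mathrm{var}_\lambda(f,\{P_1,P_2\}):=\sum_{k\ge 0}\Big(\lambda^{2k}\langle \bar f,(P_1P_2)^k(\mathrm{Id}+\lambda P_1)\bar f\rangle_\mu+\lambda^{2k}\langle \bar f,(P_2P_1)^k(\mathrm{Id}+\lambda P_2)\bar f\rangle_\mu\Big)-\|\bar f\|_\mu^2 .$$ Let $\psi\colon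 E\to E$ be a measurable bijection with $\psi^{-1}=\xi\circ\psi\circ\xi$. Let $\mu^{\xi\circ\psi}$ be the image of $\mu$ under $\xi\circ\psi$, $\nu=\mu+\mu^{\xi\circ\psi}$, and let $r(z)=\frac{\mathrm d\mu^{\xi\circ\psi}/\mathrm d\nu(z)}{\mathrm d\mu/\mathrm d\nu(z)}$ where both densities are positive, $r(z)=0$ otherwise. An acceptance function is a measurable $\phi\colon\mathbb R_+\to[0,1]$ with $\phi(0)=0$ and $r\,\phi(r^{-1})=\phi(r)$ for $r>0$; the associated metropolized flow kernel is $$P_\phi(z,\mathrm dz')=\phi(r(z))\,\delta_{\psi(z)}(\mathrm dz')+[1-\phi(r(z))]\,\delta_{\xi(z)}(\mathrm dz').$$ **Theorem.** Let $P$ be a $(\mu,Q)$-reversible Markov kernel, let $f\in L^2(\mu)$ satisfy $Qf=f$, and let $\lambda\in[0,1)$. For every acceptance function $\phi$, $\mathrm{var}_\lambda(f,\{P,P_\phi\})$ is well defined (the inner products are finite and the series converge absolutely). If $\phi_1,\phi_2$ are acceptance functions with $\phi_1\ge\phi_2$, then $$\mathrm{var}_\lambda(f,\{P,P_{\phi_1}\})\le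 \mathrm{var}_\lambda(f,\{P,P_{\phi_2}\}).$$ In particular $\phi(r)=\min\{1,r\}$ is an acceptance function, and it achieves the smallest value of $\mathrm{var}_\lambda(f,\{P,P_\phi\})$ among all acceptance functions $\phi$. This applies to Horowitz-type Hamiltonian Monte Carlo: let $E=\mathbb R\times\mathbb R$, $\mu=\rho\otimes\mathcal N(0,\sigma^2)$ with $\rho$ a probability distribution on $\mathbb R$ and $\sigma^2>0$, $\xi(x,v)=(x,-v)$, $\omega\in(0,\pi/2]$, and let $R_\omega$ be the Markov kernel that moves $(x,v)$ to $(x,v\cos\omega+v'\sin\omega)$ with $v'\sim\mathcal N(0,\sigma^2)$. Then $Q$ is an isometric involution of $L^2(\mu)$ and $R_\omega$ is $(\mu,Q)$-reversible, so that for every measurable bijection $\psi$ with $\psi^{-1}=\xi\circ\psi\circ\xi$ the above conclusions hold with $P=R_\omega$. If $p\colon\mathbb R\to(0,\infty)$ is differentiable, $\varpi$ is the density of $\mathcal N(0,\sigma^2)$ and $H(x,v)=-\log(p(x)\varpi(v))$, then for every $t\in\mathbb R$ the Störmer–Verlet map $\psi=\psi^B_{t/2}\circ\psi^A_t\circ\psi^B_{t/2}$,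 where $\psi^A_t(x,v)=(x+t\,\partial_vH(x,v),v)$ and $\psi^B_t(x,v)=(x,v-t\,\partial_xH(x,v))$, is such a $\psi$. -/

import Mathlib

open MeasureTheory ProbabilityTheory
open scoped NNReal ENNReal

namespace PeskunTierney

section General

variable {E : Type*} [MeasurableSpace E]

/-- The operator associated with a kernel: `(P f)(z) = ∫ f(z') P(z, dz')`. -/
noncomputable def act (P : Kernel E E) (f : E → ℝ) : E → ℝ :=
  fun z => ∫ z', f z' ∂(P z)

/-- The operator `Q f = f ∘ ξ` attached to a map `ξ`. -/
def flipOp (ξ : E → E) (f : E → ℝ) : E → ℝ := fun z => f (ξ z)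

/-- `ξ` is a measurable involution whose operator `Q f = f ∘ ξ` is an isometric involution of
`L²(μ)`, that is `Q² = Id` and `⟨Q f, Q g⟩ = ⟨f, g⟩`. -/
structure IsIsometricInvolution (μ : Measure E) (ξ : E → E) : Prop where
  measurable : Measurable ξ
  involutive : Function.Involutive ξ
  isometry : ∀ f g : E → ℝ, MemLp f 2 μ → MemLp g 2 μ →
    ∫ z, flipOp ξ f z * flipOp ξ g z ∂μ = ∫ z, f z * g z ∂μ

/-- `(μ, Q)`-reversibility of a kernel, where `Q f = f ∘ ξ`:
`⟨P f, g⟩ = ⟨f, Q P Q g⟩` for all `f, g ∈ L²(μ)`. -/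
def IsReversible (μ : Measure E) (ξ : E → E) (P : Kernel E E) : Prop :=
  ∀ f g : E → ℝ, MemLp f 2 μ → MemLp g 2 μ →
    ∫ z, act P f z * g z ∂μ = ∫ z, f z * flipOp ξ (act P (flipOp ξ g)) z ∂μ

/-- `ψ` is a (measurable) bijection with inverse `ξ ∘ ψ ∘ ξ`. -/
structure IsTimeReversible (ξ ψ : E → E) : Prop where
  measurable : Measurable ψ
  left_inv : Function.LeftInverse (ξ ∘ ψ ∘ ξ) ψ
  right_inv : Function.RightInverse (ξ ∘ ψ ∘ ξ) ψ

/-- Acceptance functions: `φ : ℝ₊ → [0, 1]` with `r φ(1/r) = φ(r)` for `r > 0` and `φ(0) = 0`. -/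
structure IsAcceptance (φ : ℝ≥0 → ℝ≥0) : Prop where
  measurable : Measurable φ
  le_one : ∀ r, φ r ≤ 1
  balance : ∀ r, 0 < r → r * φ r⁻¹ = φ r
  map_zero : φ 0 = 0

open Classical in
/-- The ratio `r = (dμ^{ξ∘ψ}/dν) / (dμ/dν)` with `ν = μ + μ^{ξ∘ψ}`, set to `0` where one of the
two densities vanishes. -/
noncomputable def ratio (μ : Measure E) (ξ ψ : E → E) (z : E) : ℝ≥0 :=
  if 0 < (μ.map (ξ ∘ ψ)).rnDeriv (μ + μ.map (ξ ∘ ψ)) z ∧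
      0 < μ.rnDeriv (μ + μ.map (ξ ∘ ψ)) z then
    ((μ.map (ξ ∘ ψ)).rnDeriv (μ + μ.map (ξ ∘ ψ)) z).toNNReal /
      (μ.rnDeriv (μ + μ.map (ξ ∘ ψ)) z).toNNReal
  else 0

theorem measurable_ratio (μ : Measure E) (ξ ψ : E → E) : Measurable (ratio μ ξ ψ) := by
  unfold ratio
  refine Measurable.ite ?_ ?_ measurable_const
  · exact (measurableSet_lt measurable_const (Measure.measurable_rnDeriv _ _)).inter
      (measurableSet_lt measurable_const (Measure.measurable_rnDeriv _ _))
  · exact (Measure.measurable_rnDeriv _ _).ennreal_toNNReal.div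
      (Measure.measurable_rnDeriv _ _).ennreal_toNNReal

/-- The metropolized flow kernel
`P(z, ·) = φ(r(z)) δ_{ψ(z)} + (1 - φ(r(z))) δ_{ξ(z)}`. -/
noncomputable def metropolizedFlow (μ : Measure E) (ξ ψ : E → E) (φ : ℝ≥0 → ℝ≥0)
    (hξ : Measurable ξ) (hψ : Measurable ψ) (hφ : Measurable φ) : Kernel E E where
  toFun z := (φ (ratio μ ξ ψ z) : ℝ≥0∞) • Measure.dirac (ψ z) +
    (1 - (φ (ratio μ ξ ψ z) : ℝ≥0∞)) • Measure.dirac (ξ z)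
  measurable' := by
    have h : Measurable fun z => (φ (ratio μ ξ ψ z) : ℝ≥0∞) :=
      (hφ.comp (measurable_ratio μ ξ ψ)).coe_nnreal_ennreal
    refine Measure.measurable_of_measurable_coe _ fun s hs => ?_
    simp only [Measure.add_apply, Measure.smul_apply, smul_eq_mul]
    exact (h.mul ((Measure.measurable_coe hs).comp (Measure.measurable_dirac.comp hψ))).add
      ((measurable_const.sub h).mul
        ((Measure.measurable_coe hs).comp (Measure.measurable_dirac.comp hξ)))

/-- `f̄ = f - μ(f)`. -/
noncomputable def centered (μ : Measure E) (f : E → ℝ) : E → ℝ := fun z => f z - ∫ y, f y ∂μ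

/-- The function `f̄ · (P₁ P₂)^k (Id + lam P₁) f̄`. -/
noncomputable def cycleIntegrand (μ : Measure E) (lam : ℝ) (f : E → ℝ) (P₁ P₂ : Kernel E E)
    (k : ℕ) : E → ℝ := fun z =>
  centered μ f z * ((fun g => act P₁ (act P₂ g))^[k]
    (fun y => centered μ f y + lam * act P₁ (centered μ f) y)) z

/-- `lam^(2k) ⟨f̄, (P₁ P₂)^k (Id + lam P₁) f̄⟩`. -/
noncomputable def cycleTerm (μ : Measure E) (lam : ℝ) (f : E → ℝ) (P₁ P₂ : Kernel E E)
    (k : ℕ) : ℝ := lam ^ (2 * k) * ∫ z, cycleIntegrand μ lam f P₁ P₂ k z ∂μ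

/-- The `lam`-asymptotic variance of the 2-cycle `{P₁, P₂}`. -/
noncomputable def cycleVar (μ : Measure E) (lam : ℝ) (f : E → ℝ) (P₁ P₂ : Kernel E E) : ℝ :=
  ∑' k, (cycleTerm μ lam f P₁ P₂ k + cycleTerm μ lam f P₂ P₁ k) - ∫ z, centered μ f z ^ 2 ∂μ

/-- All inner products in `cycleVar` are finite, and both series converge absolutely. -/
def CycleVarWellDefined (μ : Measure E) (lam : ℝ) (f : E → ℝ) (P₁ P₂ : Kernel E E) : Prop :=
  (∀ k, Integrable (cycleIntegrand μ lam f P₁ P₂ k) μ) ∧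
  (∀ k, Integrable (cycleIntegrand μ lam f P₂ P₁ k) μ) ∧
  Summable (cycleTerm μ lam f P₁ P₂) ∧ Summable (cycleTerm μ lam f P₂ P₁)

end General

/-- Momentum reversal `(x, v) ↦ (x, -v)`. -/
def momentumFlip (z : ℝ × ℝ) : ℝ × ℝ := (z.1, -z.2)

/-- Partial momentum refreshment: from `(x, v)` move to `(x, v cos ω + v' sin ω)` with
`v' ∼ N(0, s)`, where `s` is the variance. -/
noncomputable def refreshment (s : ℝ≥0) (ω : ℝ) : Kernel (ℝ × ℝ) (ℝ × ℝ) where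
  toFun z := (gaussianReal 0 s).map fun v' => (z.1, z.2 * Real.cos ω + v' * Real.sin ω)
  measurable' := by
    refine Measure.measurable_of_measurable_coe _ fun t ht => ?_
    have hm : Measurable fun q : (ℝ × ℝ) × ℝ =>
        (q.1.1, q.1.2 * Real.cos ω + q.2 * Real.sin ω) := by fun_prop
    have key := measurable_measure_prodMk_left (ν := gaussianReal 0 s) (hm ht)
    convert key using 2 with z
    rw [Measure.map_apply (by fun_prop) ht]
    rfl

/-- `(x, v) ↦ (x + t ∂H/∂v(x, v), v)`. -/
noncomputable def drift (H : ℝ × ℝ → ℝ) (t : ℝ) (z : ℝ × ℝ) : ℝ × ℝ :=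
  (z.1 + t * deriv (fun w => H (z.1, w)) z.2, z.2)

/-- `(x, v) ↦ (x, v - t ∂H/∂x(x, v))`. -/
noncomputable def kick (H : ℝ × ℝ → ℝ) (t : ℝ) (z : ℝ × ℝ) : ℝ × ℝ :=
  (z.1, z.2 - t * deriv (fun y => H (y, z.2)) z.1)

/-- One Störmer–Verlet (leapfrog) step of length `t` for the Hamiltonian `H`. -/
noncomputable def verlet (H : ℝ × ℝ → ℝ) (t : ℝ) : ℝ × ℝ → ℝ × ℝ :=
  kick H (t / 2) ∘ drift H t ∘ kick H (t / 2)

/-- The Hamiltonian `H = - log (p(x) ϖ(v))`, `ϖ` being the density of `N(0, s)`. -/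
noncomputable def hamiltonian (p : ℝ → ℝ) (s : ℝ≥0) (z : ℝ × ℝ) : ℝ :=
  -Real.log (p z.1 * gaussianPDFReal 0 s z.2)

end PeskunTierney

open PeskunTierney

/-! Write K for P_φ and F for the class of the centred f. The block operator M(x, y) = (P y, K x) on
L²(μ) × L²(μ) has even powers acting diagonally by (PK)^k and (KP)^k, while its odd powers supply
the λP and λK terms. So var_λ equals l((1 - λM)⁻¹(F, F)) - ‖F‖² with l(x, y) = ⟨F, x⟩ + ⟨F, y⟩
(`cycleVar_eq`).

Move K linearly from K₂ to K₁. With A = 1 - λM_t and D = M₁ - M₂, the derivative of this form is λ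
l(A⁻¹ D A⁻¹(F, F)). M need not be self-adjoint, but (μ, Q)-reversibility makes QP and QK symmetric,
hence also JM, where J(x, y) = (Q y, Q x). Since J fixes (F, F), the outer A⁻¹ can be moved onto the
left factor, and with u = A⁻¹(F, F) the derivative becomes λ⟨Q u₁, (K₁ - K₂) u₁⟩
(`pairForm_resolvent_mono`). The ordering thus reduces to ⟨Qu, K₁u⟩ ≤ ⟨Qu, K₂u⟩ for all u.

For metropolized flows, T = ξ ∘ ψ is an involution, and r φ(1/r) = φ(r) is exactly what makes φ(r) μ
invariant under T (`measurePreserving_acceptedMeasure`). This yields reversibility and ⟨Qu, P_φ u⟩ =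
‖Qu‖² - ½ ∫ (Qu ∘ T - Qu)² φ(r) dμ, which decreases as φ grows. Finally φ(r) = r φ(1/r) ≤ r, so
min(1, r) dominates every acceptance function.

For momentum refreshment, reversibility is the rotation invariance of a pair of independent centred
Gaussians of equal variance. -/

namespace PeskunTierney

/-! ### Resolvents of contractions on a Banach space, and their derivative along a segment. -/

section Resolvent

variable {X : Type*} [NormedAddCommGroup X] [NormedSpace ℝ X]

theorem norm_smul_lt_one {M : X →L[ℝ] X} (hM : ‖M‖ ≤ 1) {c : ℝ} (hc₀ : 0 ≤ c) (hc₁ : c < 1) :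
    ‖c • M‖ < 1 := by
  rw [norm_smul, Real.norm_of_nonneg hc₀]
  nlinarith

variable [CompleteSpace X]

theorem isUnit_one_sub_smul {M : X →L[ℝ] X} (hM : ‖M‖ ≤ 1) {c : ℝ} (hc₀ : 0 ≤ c) (hc₁ : c < 1) :
    IsUnit (1 - c • M) :=
  ⟨Units.oneSub _ (norm_smul_lt_one hM hc₀ hc₁), rfl⟩

/-- The Neumann series of the resolvent, tested against a functional. -/
theorem hasSum_resolvent {M : X →L[ℝ] X} (hM : ‖M‖ ≤ 1) {c : ℝ} (hc₀ : 0 ≤ c) (hc₁ : c < 1)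
    (l : X →L[ℝ] ℝ) (F : X) :
    HasSum (fun k : ℕ => l (((c • M) ^ k) F)) (l (Ring.inverse (1 - c • M) F)) := by
  have hn := norm_smul_lt_one hM hc₀ hc₁
  have h : HasSum (fun k : ℕ => (c • M) ^ k) (Ring.inverse (1 - c • M)) := by
    rw [NormedRing.inverse_one_sub _ hn]
    exact (summable_geometric_of_norm_lt_one hn).hasSum
  exact h.mapL (l.comp (ContinuousLinearMap.apply ℝ X F))

/-- The derivative of inversion at A is B ↦ -A⁻¹ B A⁻¹; the inner derivative -cD cancels the sign.
-/
theorem hasDerivAt_resolvent {M D : X →L[ℝ] X} {c t : ℝ} (h : IsUnit (1 - c • (M + t • D))) :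
    HasDerivAt (fun s : ℝ => Ring.inverse (1 - c • (M + s • D)))
      (c • (Ring.inverse (1 - c • (M + t • D)) * D * Ring.inverse (1 - c • (M + t • D)))) t := by
  obtain ⟨u, hu⟩ := h
  have h₁ : HasDerivAt (fun s : ℝ => 1 - c • (M + s • D)) (-(c • D)) t := by
    have := ((((hasDerivAt_id t).smul_const D).const_add M).const_smul c).const_sub 1
    simpa using this
  have h₂ := hasFDerivAt_ringInverse (𝕜 := ℝ) u
  rw [hu] at h₂
  have h₃ := h₂.comp_hasDerivAt t h₁
  have h₄ : (-ContinuousLinearMap.mulLeftRight ℝ (X →L[ℝ] X) ↑u⁻¹ ↑u⁻¹) (-(c • D)) =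
      c • (Ring.inverse (1 - c • (M + t • D)) * D * Ring.inverse (1 - c • (M + t • D))) := by
    rw [← hu, Ring.inverse_unit]
    simp
  rw [← h₄]
  exact h₃

/-- If the derivative of the resolvent form is nonpositive along the segment from `M₂` to `M₁`,
the resolvent form is smaller at `M₁`. -/
theorem resolvent_le_of_deriv_nonpos {M₁ M₂ : X →L[ℝ] X} (hM₁ : ‖M₁‖ ≤ 1) (hM₂ : ‖M₂‖ ≤ 1)
    {c : ℝ} (hc₀ : 0 ≤ c) (hc₁ : c < 1) (l : X →L[ℝ] ℝ) (F : X)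
    (h : ∀ t ∈ Set.Icc (0 : ℝ) 1, IsUnit (1 - c • (M₂ + t • (M₁ - M₂))) →
      l (Ring.inverse (1 - c • (M₂ + t • (M₁ - M₂)))
        ((M₁ - M₂) (Ring.inverse (1 - c • (M₂ + t • (M₁ - M₂))) F))) ≤ 0) :
    l (Ring.inverse (1 - c • M₁) F) ≤ l (Ring.inverse (1 - c • M₂) F) := by
  -- Contractions form a convex set, so the resolvent exists on the whole segment.
  have hu : ∀ t ∈ Set.Icc (0 : ℝ) 1, IsUnit (1 - c • (M₂ + t • (M₁ - M₂))) := by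
    intro t ht
    refine isUnit_one_sub_smul ?_ hc₀ hc₁
    have : M₂ + t • (M₁ - M₂) = (1 - t) • M₂ + t • M₁ := by module
    rw [this]
    refine (norm_add_le _ _).trans ?_
    rw [norm_smul, norm_smul, Real.norm_of_nonneg ht.1, Real.norm_of_nonneg (sub_nonneg.2 ht.2)]
    nlinarith [ht.1, ht.2]
  set v : ℝ → ℝ := fun t => l (Ring.inverse (1 - c • (M₂ + t • (M₁ - M₂))) F) with hv
  have hd : ∀ t ∈ Set.Icc (0 : ℝ) 1, HasDerivAt v
      (c * l (Ring.inverse (1 - c • (M₂ + t • (M₁ - M₂)))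
        ((M₁ - M₂) (Ring.inverse (1 - c • (M₂ + t • (M₁ - M₂))) F)))) t := by
    intro t ht
    have := ((l.comp (ContinuousLinearMap.apply ℝ X F)).hasFDerivAt).comp_hasDerivAt t
      (hasDerivAt_resolvent (hu t ht))
    simpa [hv] using! this
  have hanti : AntitoneOn v (Set.Icc 0 1) := by
    refine antitoneOn_of_deriv_nonpos (convex_Icc 0 1)
      (fun t ht => (hd t ht).continuousAt.continuousWithinAt)
      (fun t ht => (hd t (interior_subset ht)).differentiableAt.differentiableWithinAt) ?_
    intro t ht
    have ht' := interior_subset ht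
    rw [(hd t ht').deriv]
    exact mul_nonpos_of_nonneg_of_nonpos hc₀ (h t ht' (hu t ht'))
  have := hanti (Set.left_mem_Icc.2 zero_le_one) (Set.right_mem_Icc.2 zero_le_one) zero_le_one
  simp only [hv, one_smul, zero_smul, add_zero, add_sub_cancel] at this
  exact this

end Resolvent

/-! ### The block operator of a 2-cycle and the sign of the derivative. -/

section Cycle

variable {H : Type*} [NormedAddCommGroup H] [InnerProductSpace ℝ H]

/-- The block operator `(x, y) ↦ (P y, K x)`, whose square is `(P K, K P)`. -/
noncomputable def cycleOp (P K : H →L[ℝ] H) : (H × H) →L[ℝ] (H × H) :=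
  (P.comp (ContinuousLinearMap.snd ℝ H H)).prod (K.comp (ContinuousLinearMap.fst ℝ H H))

@[simp]
theorem cycleOp_apply (P K : H →L[ℝ] H) (x : H × H) : cycleOp P K x = (P x.2, K x.1) := rfl

/-- The product carries the sup norm, which is why the resolvent results are stated for Banach
spaces and a functional rather than for an inner product. -/
theorem norm_cycleOp_le {P K : H →L[ℝ] H} (hP : ‖P‖ ≤ 1) (hK : ‖K‖ ≤ 1) : ‖cycleOp P K‖ ≤ 1 := by
  refine ContinuousLinearMap.opNorm_le_bound _ zero_le_one fun x => ?_
  rw [cycleOp_apply, Prod.norm_def, one_mul]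
  refine max_le ?_ ?_
  · exact (P.le_of_opNorm_le hP _).trans (by rw [one_mul]; exact norm_snd_le x)
  · exact (K.le_of_opNorm_le hK _).trans (by rw [one_mul]; exact norm_fst_le x)

theorem cycleOp_pow_even (P K : H →L[ℝ] H) (k : ℕ) (x y : H) :
    (cycleOp P K ^ (2 * k)) (x, y) = (((P * K) ^ k) x, ((K * P) ^ k) y) := by
  rw [pow_mul]
  induction k generalizing x y with
  | zero => rfl
  | succ k ih =>
    rw [pow_succ _ k, pow_succ _ k, pow_succ _ k]
    exact ih _ _

theorem cycleOp_pow_odd (P K : H →L[ℝ] H) (k : ℕ) (x y : H) :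
    (cycleOp P K ^ (2 * k + 1)) (x, y) = (((P * K) ^ k) (P y), ((K * P) ^ k) (K x)) := by
  rw [pow_succ, mul_apply_eq_comp, cycleOp_apply, cycleOp_pow_even]

/-- The functional `(x, y) ↦ ⟨f, x⟩ + ⟨f, y⟩`. -/
noncomputable def pairForm (f : H) : (H × H) →L[ℝ] ℝ :=
  (innerSL ℝ f).comp (ContinuousLinearMap.fst ℝ H H) +
    (innerSL ℝ f).comp (ContinuousLinearMap.snd ℝ H H)

@[simp]
theorem pairForm_apply (f : H) (x : H × H) : pairForm f x = inner ℝ f x.1 + inner ℝ f x.2 := rfl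

/-- Monotonicity of the resolvent form of a 2-cycle in its second operator. -/
theorem pairForm_resolvent_mono [CompleteSpace H] {P K₁ K₂ Q : H →L[ℝ] H} (hP : ‖P‖ ≤ 1)
    (hK₁ : ‖K₁‖ ≤ 1) (hK₂ : ‖K₂‖ ≤ 1)
    (hQ : ∀ x y, inner ℝ (Q x) y = inner ℝ x (Q y))
    (hQP : ∀ x y, inner ℝ (Q (P x)) y = inner ℝ x (Q (P y)))
    (hQK₁ : ∀ x y, inner ℝ (Q (K₁ x)) y = inner ℝ x (Q (K₁ y)))
    (hQK₂ : ∀ x y, inner ℝ (Q (K₂ x)) y = inner ℝ x (Q (K₂ y)))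
    (hle : ∀ x, inner ℝ (Q x) (K₁ x) ≤ inner ℝ (Q x) (K₂ x))
    {f : H} (hf : Q f = f) {c : ℝ} (hc₀ : 0 ≤ c) (hc₁ : c < 1) :
    pairForm f (Ring.inverse (1 - c • cycleOp P K₁) (f, f)) ≤
      pairForm f (Ring.inverse (1 - c • cycleOp P K₂) (f, f)) := by
  have hM₁ := norm_cycleOp_le hP hK₁
  have hM₂ := norm_cycleOp_le hP hK₂
  refine resolvent_le_of_deriv_nonpos (X := H × H) (M₁ := cycleOp P K₁) (M₂ := cycleOp P K₂)
    hM₁ hM₂ hc₀ hc₁ (pairForm f) (f, f) fun t ht hu => ?_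
  set A := 1 - c • (cycleOp P K₂ + t • (cycleOp P K₁ - cycleOp P K₂)) with hA
  set K := K₂ + t • (K₁ - K₂) with hK
  have hAapp : ∀ x : H × H, A x = (x.1 - c • P x.2, x.2 - c • K x.1) := by
    intro x
    ext <;> simp [hA, hK]
  have hQK : ∀ x y, inner ℝ (Q (K x)) y = inner ℝ x (Q (K y)) := by
    intro x y
    simp [hK, inner_add_left, inner_add_right, inner_sub_left, inner_sub_right, inner_smul_left,
      inner_smul_right, hQK₁, hQK₂]
  have hright : ∀ x, A (Ring.inverse A x) = x := fun x => by
    rw [← mul_apply_eq_comp, Ring.mul_inverse_cancel _ hu,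
      one_apply_eq_self]
  set u := Ring.inverse A (f, f)
  set y := (cycleOp P K₁ - cycleOp P K₂) u with hy
  set w := Ring.inverse A y
  have hAu : A u = (f, f) := hright _
  have hAw : A w = y := hright _
  rw [hAapp] at hAu hAw
  have hf₁ : f = u.1 - c • P u.2 := (congrArg Prod.fst hAu).symm
  have hf₂ : f = u.2 - c • K u.1 := (congrArg Prod.snd hAu).symm
  have hy₁ : w.1 - c • P w.2 = 0 :=
    (congrArg Prod.fst hAw).trans (by simp [hy])
  have hy₂ : w.2 - c • K w.1 = K₁ u.1 - K₂ u.1 :=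
    (congrArg Prod.snd hAw).trans (by simp [hy])
  -- Pair A w = y with J u = (Q u₂, Q u₁). Symmetry of QP and QK turns this into the pairing of J A
  -- u = (f, f) with w, and y has first component 0, so only the term with Q u₁ survives.
  have key : pairForm f w = inner ℝ (Q u.1) (K₁ u.1) - inner ℝ (Q u.1) (K₂ u.1) := by
    have e₁ : inner ℝ f w.1 = inner ℝ (Q u.2) w.1 - c * inner ℝ (Q u.1) (K w.1) := by
      rw [← hf]
      conv_lhs => rw [hf₂]
      rw [map_sub, map_smul, inner_sub_left, inner_smul_left, hQK, hQ u.1]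
      rfl
    have e₂ : inner ℝ f w.2 = inner ℝ (Q u.1) w.2 - c * inner ℝ (Q u.2) (P w.2) := by
      rw [← hf]
      conv_lhs => rw [hf₁]
      rw [map_sub, map_smul, inner_sub_left, inner_smul_left, hQP, hQ u.2]
      rfl
    have e₃ := congrArg (inner ℝ (Q u.2)) hy₁
    have e₄ := congrArg (inner ℝ (Q u.1)) hy₂
    rw [inner_sub_right, inner_smul_right, inner_zero_right] at e₃
    rw [inner_sub_right, inner_smul_right, inner_sub_right] at e₄
    rw [pairForm_apply]
    linarith
  rw [key]
  linarith [hle u.1]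

end Cycle

/-! ### Invariant Markov kernels as contractions of L². -/

section KernelOperator

variable {E : Type*} [MeasurableSpace E] {μ : Measure E} {P : Kernel E E}

/-- By invariance, a μ-null set is P(z, ·)-null for μ-almost every z; hence the action descends to
classes of functions. -/
theorem act_congr (hP : P.Invariant μ) {f g : E → ℝ} (h : f =ᵐ[μ] g) :
    act P f =ᵐ[μ] act P g := by
  have h' : ∀ᵐ z ∂(μ.bind P), f z = g z := by rw [hP.def]; exact h
  filter_upwards [Measure.ae_ae_of_ae_comp h'] with z hz using integral_congr_ae hz

theorem stronglyMeasurable_act [IsSFiniteKernel P] {f : E → ℝ} (hf : StronglyMeasurable f) :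
    StronglyMeasurable (act P f) := hf.integral_kernel

theorem aestronglyMeasurable_act [IsSFiniteKernel P] (hP : P.Invariant μ) {f : E → ℝ}
    (hf : AEStronglyMeasurable f μ) : AEStronglyMeasurable (act P f) μ :=
  ⟨act P (hf.mk f), stronglyMeasurable_act hf.stronglyMeasurable_mk, act_congr hP hf.ae_eq_mk⟩

/-- Under each probability P(z, ·) the L¹ norm is at most the L² norm, so |Pf|² ≤ P|f|²; integrating
against μ and using μP = μ gives the bound. -/
theorem eLpNorm_act_le [IsMarkovKernel P] (hP : P.Invariant μ) {f : E → ℝ}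
    (hf : AEStronglyMeasurable f μ) : eLpNorm (act P f) 2 μ ≤ eLpNorm f 2 μ := by
  rw [eLpNorm_congr_ae (act_congr hP hf.ae_eq_mk), eLpNorm_congr_ae hf.ae_eq_mk]
  set g := hf.mk f
  have hg : StronglyMeasurable g := hf.stronglyMeasurable_mk
  have two (ν : Measure E) (h : E → ℝ) : eLpNorm h 2 ν = (∫⁻ x, ‖h x‖ₑ ^ 2 ∂ν) ^ (1 / 2 : ℝ) := by
    rw [eLpNorm_eq_lintegral_rpow_enorm_toReal two_ne_zero ENNReal.ofNat_ne_top]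
    simp
  rw [two, two]
  refine ENNReal.rpow_le_rpow ?_ (by norm_num)
  conv_rhs => rw [← hP.def]
  rw [Measure.lintegral_bind P.aemeasurable (hg.enorm.pow_const 2).aemeasurable]
  refine lintegral_mono fun z => ?_
  have h₁ : ‖act P g z‖ₑ ≤ eLpNorm g 2 (P z) :=
    (enorm_integral_le_lintegral_enorm _).trans (by
      rw [← eLpNorm_one_eq_lintegral_enorm]
      exact eLpNorm_le_eLpNorm_of_exponent_le one_le_two hg.aestronglyMeasurable)
  calc ‖act P g z‖ₑ ^ 2 ≤ eLpNorm g 2 (P z) ^ 2 := by gcongr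
    _ = ∫⁻ x, ‖g x‖ₑ ^ 2 ∂(P z) := by
      rw [two, ← ENNReal.rpow_natCast, ← ENNReal.rpow_mul]
      norm_num

theorem memLp_act [IsMarkovKernel P] (hP : P.Invariant μ) {f : E → ℝ} (hf : MemLp f 2 μ) :
    MemLp (act P f) 2 μ :=
  ⟨aestronglyMeasurable_act hP hf.1, (eLpNorm_act_le hP hf.1).trans_lt hf.2⟩

/-- Additivity holds only almost everywhere: an L² function is guaranteed to be P(z, ·)-integrable
only for μ-almost every z. -/
theorem act_add [IsFiniteMeasure μ] [IsMarkovKernel P] (hP : P.Invariant μ) {f g : E → ℝ}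
    (hf : MemLp f 2 μ) (hg : MemLp g 2 μ) : act P (f + g) =ᵐ[μ] act P f + act P g := by
  have int {h : E → ℝ} (hh : MemLp h 2 μ) : ∀ᵐ z ∂μ, Integrable h (P z) := by
    refine Measure.ae_integrable_of_integrable_comp ?_
    rw [hP.def]
    exact hh.integrable one_le_two
  filter_upwards [int hf, int hg] with z h₁ h₂ using integral_add h₁ h₂

theorem act_smul (c : ℝ) (f : E → ℝ) : act P (c • f) = c • act P f :=
  funext fun _ => integral_const_mul c f

/-- The contraction of `L²(μ)` associated with a `μ`-invariant Markov kernel. -/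
noncomputable def kernelOp [IsFiniteMeasure μ] (P : Kernel E E) [IsMarkovKernel P]
    (hP : P.Invariant μ) : Lp ℝ 2 μ →L[ℝ] Lp ℝ 2 μ :=
  LinearMap.mkContinuous
    { toFun := fun f => (memLp_act hP (Lp.memLp f)).toLp
      map_add' := fun f g => by
        rw [← MemLp.toLp_add]
        exact MemLp.toLp_congr _ _
          ((act_congr hP (Lp.coeFn_add f g)).trans (act_add hP (Lp.memLp f) (Lp.memLp g)))
      map_smul' := fun c f => by
        rw [RingHom.id_apply, ← MemLp.toLp_const_smul]
        refine MemLp.toLp_congr _ _ ((act_congr hP (Lp.coeFn_smul c f)).trans ?_)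
        rw [act_smul] } 1
    fun f => by
      rw [one_mul, LinearMap.coe_mk, AddHom.coe_mk, Lp.norm_toLp, Lp.norm_def]
      exact ENNReal.toReal_mono (Lp.memLp f).2.ne (eLpNorm_act_le hP (Lp.memLp f).1)

theorem kernelOp_toLp [IsFiniteMeasure μ] [IsMarkovKernel P] (hP : P.Invariant μ) {f : E → ℝ}
    (hf : MemLp f 2 μ) : kernelOp P hP hf.toLp = (memLp_act hP hf).toLp :=
  MemLp.toLp_congr (memLp_act hP (Lp.memLp _)) (memLp_act hP hf) (act_congr hP hf.coeFn_toLp)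

theorem norm_kernelOp_le [IsFiniteMeasure μ] [IsMarkovKernel P] (hP : P.Invariant μ) :
    ‖kernelOp P hP‖ ≤ 1 :=
  LinearMap.mkContinuous_norm_le _ zero_le_one _

theorem inner_toLp {f g : E → ℝ} (hf : MemLp f 2 μ) (hg : MemLp g 2 μ) :
    inner ℝ hf.toLp hg.toLp = ∫ z, f z * g z ∂μ := by
  rw [L2.inner_def]
  refine integral_congr_ae ?_
  filter_upwards [hf.coeFn_toLp, hg.coeFn_toLp] with z h₁ h₂
  simp [h₁, h₂, mul_comm]

end KernelOperator

/-! ### The involution Q and (μ, Q)-reversibility as operator identities. -/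

section Reversibility

variable {E : Type*} [MeasurableSpace E] {μ : Measure E} {P : Kernel E E} {ξ : E → E}

/-- An indicator is its own square, so the isometry identity for it compares the measures of s and
ξ⁻¹ s. -/
theorem IsIsometricInvolution.measurePreserving [IsFiniteMeasure μ]
    (hξ : IsIsometricInvolution μ ξ) : MeasurePreserving ξ μ μ := by
  refine ⟨hξ.measurable, Measure.ext fun s hs => ?_⟩
  have hm : MemLp (s.indicator (1 : E → ℝ)) 2 μ := (memLp_const (1 : ℝ)).indicator hs
  have h := hξ.isometry _ _ hm hm
  have e₁ : ∀ z, s.indicator (1 : E → ℝ) z * s.indicator 1 z = s.indicator 1 z := fun z => by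
    by_cases hz : z ∈ s <;> simp [hz]
  simp only [flipOp, e₁] at h
  have e₂ : ∀ z, s.indicator (1 : E → ℝ) (ξ z) = (ξ ⁻¹' s).indicator 1 z := fun z => rfl
  simp only [e₂] at h
  rw [integral_indicator_one hs, integral_indicator_one (hξ.measurable hs)] at h
  rw [Measure.map_apply hξ.measurable hs]
  exact (measureReal_eq_measureReal_iff).1 h

/-- The reversibility identity for indicators against the constant one forces invariance. -/
theorem invariant_of_stronglyMeasurable [IsProbabilityMeasure μ] [IsMarkovKernel P]
    (h : ∀ f g : E → ℝ, StronglyMeasurable f → StronglyMeasurable g → MemLp f 2 μ → MemLp g 2 μ →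
      ∫ z, act P f z * g z ∂μ = ∫ z, f z * flipOp ξ (act P (flipOp ξ g)) z ∂μ) :
    P.Invariant μ := by
  refine Measure.ext fun s hs => ?_
  rw [Measure.bind_apply hs P.aemeasurable]
  have h := h (s.indicator (1 : E → ℝ)) (fun _ => 1) (stronglyMeasurable_one.indicator hs)
    stronglyMeasurable_const ((memLp_const (1 : ℝ)).indicator hs) (memLp_const 1)
  have e : ∀ z, act P (s.indicator (1 : E → ℝ)) z = (P z s).toReal := fun z =>
    integral_indicator_one hs
  have e' : flipOp ξ (act P (flipOp ξ fun _ => (1 : ℝ))) = fun _ => 1 := by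
    funext z
    simp [flipOp, act]
  simp only [e, e', mul_one] at h
  rw [integral_indicator_one hs, integral_toReal (P.measurable_coe hs).aemeasurable
    (.of_forall fun z => measure_lt_top _ _)] at h
  refine (ENNReal.toReal_eq_toReal_iff' ?_ (measure_ne_top _ _)).1 h
  refine ne_top_of_le_ne_top (measure_ne_top μ Set.univ) ?_
  calc ∫⁻ z, P z s ∂μ ≤ ∫⁻ _, 1 ∂μ := lintegral_mono fun z => prob_le_one
    _ = μ Set.univ := by simp

theorem IsReversible.invariant [IsProbabilityMeasure μ] [IsMarkovKernel P]
    (h : IsReversible μ ξ P) : P.Invariant μ :=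
  invariant_of_stronglyMeasurable fun f g _ _ => h f g

theorem memLp_flipOp (hξ : MeasurePreserving ξ μ μ) {f : E → ℝ} (hf : MemLp f 2 μ) :
    MemLp (flipOp ξ f) 2 μ := hf.comp_measurePreserving hξ

theorem flipOp_congr (hξ : MeasurePreserving ξ μ μ) {f g : E → ℝ} (h : f =ᵐ[μ] g) :
    flipOp ξ f =ᵐ[μ] flipOp ξ g := hξ.quasiMeasurePreserving.ae_eq_comp h

/-- Reversibility has to be checked for strongly measurable functions only. -/
theorem isReversible_of_stronglyMeasurable [IsProbabilityMeasure μ] [IsMarkovKernel P]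
    (hξ : MeasurePreserving ξ μ μ)
    (h : ∀ f g : E → ℝ, StronglyMeasurable f → StronglyMeasurable g → MemLp f 2 μ → MemLp g 2 μ →
      ∫ z, act P f z * g z ∂μ = ∫ z, f z * flipOp ξ (act P (flipOp ξ g)) z ∂μ) :
    IsReversible μ ξ P := by
  intro f g hf hg
  -- Invariance must come first: it is what permits replacing f and g by measurable representatives
  -- under the kernel.
  have hP := invariant_of_stronglyMeasurable h
  have hf' := hf.1.ae_eq_mk
  have hg' := hg.1.ae_eq_mk
  have h₁ : (fun z => act P f z * g z) =ᵐ[μ] fun z => act P (hf.1.mk f) z * hg.1.mk g z :=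
    (act_congr hP hf').mul hg'
  have h₂ : (fun z => f z * flipOp ξ (act P (flipOp ξ g)) z) =ᵐ[μ]
      fun z => hf.1.mk f z * flipOp ξ (act P (flipOp ξ (hg.1.mk g))) z :=
    hf'.mul (flipOp_congr hξ (act_congr hP (flipOp_congr hξ hg')))
  rw [integral_congr_ae h₁, integral_congr_ae h₂]
  exact h _ _ hf.1.stronglyMeasurable_mk hg.1.stronglyMeasurable_mk (hf.ae_eq hf') (hg.ae_eq hg')

/-- `Q` as an operator of `L²(μ)`. -/
noncomputable def flipL2 (hξ : MeasurePreserving ξ μ μ) : Lp ℝ 2 μ →L[ℝ] Lp ℝ 2 μ :=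
  (Lp.compMeasurePreservingₗᵢ ℝ ξ hξ).toContinuousLinearMap

theorem flipL2_toLp (hξ : MeasurePreserving ξ μ μ) {f : E → ℝ} (hf : MemLp f 2 μ) :
    flipL2 hξ hf.toLp = (memLp_flipOp hξ hf).toLp :=
  Lp.toLp_compMeasurePreserving hf hξ

theorem integral_flipOp_mul [IsFiniteMeasure μ] (hξ : IsIsometricInvolution μ ξ) {f g : E → ℝ}
    (hf : MemLp f 2 μ) (hg : MemLp g 2 μ) :
    ∫ z, flipOp ξ f z * g z ∂μ = ∫ z, f z * flipOp ξ g z ∂μ := by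
  rw [← hξ.isometry _ _ hf (memLp_flipOp hξ.measurePreserving hg)]
  simp only [flipOp, hξ.involutive _]

theorem inner_flipL2 [IsFiniteMeasure μ] (hξ : IsIsometricInvolution μ ξ) (x y : Lp ℝ 2 μ) :
    inner ℝ (flipL2 hξ.measurePreserving x) y = inner ℝ x (flipL2 hξ.measurePreserving y) := by
  rw [← Lp.toLp_coeFn x (Lp.memLp x), ← Lp.toLp_coeFn y (Lp.memLp y), flipL2_toLp, flipL2_toLp,
    inner_toLp, inner_toLp, integral_flipOp_mul hξ (Lp.memLp x) (Lp.memLp y)]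

/-- ⟨QPx, y⟩ = ⟨Px, Qy⟩ = ⟨x, QPQQy⟩ and Q² = Id: reversibility says that QP is symmetric. -/
theorem inner_flipL2_kernelOp [IsProbabilityMeasure μ] [IsMarkovKernel P]
    (hξ : IsIsometricInvolution μ ξ) (h : IsReversible μ ξ P) (x y : Lp ℝ 2 μ) :
    inner ℝ (flipL2 hξ.measurePreserving (kernelOp P h.invariant x)) y =
      inner ℝ x (flipL2 hξ.measurePreserving (kernelOp P h.invariant y)) := by
  have hx := Lp.memLp x
  have hy := Lp.memLp y
  rw [inner_flipL2 hξ, ← Lp.toLp_coeFn x hx, ← Lp.toLp_coeFn y hy, kernelOp_toLp, kernelOp_toLp,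
    flipL2_toLp, flipL2_toLp, inner_toLp, inner_toLp,
    h _ _ hx (memLp_flipOp hξ.measurePreserving hy)]
  have : flipOp ξ (flipOp ξ y) = y := funext fun z => by simp only [flipOp, hξ.involutive z]
  rw [this]

end Reversibility

/-! ### The asymptotic variance as a resolvent form. -/

section CycleVariance

variable {E : Type*} [MeasurableSpace E] {μ : Measure E} [IsProbabilityMeasure μ]
  {P K : Kernel E E} [IsMarkovKernel P] [IsMarkovKernel K]

/-- Existential because forming the class needs the membership proof; both are carried through one
induction. -/
theorem exists_memLp_iterate_act (hP : P.Invariant μ) (hK : K.Invariant μ) {g : E → ℝ}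
    (hg : MemLp g 2 μ) (k : ℕ) :
    ∃ h : MemLp ((fun g => act P (act K g))^[k] g) 2 μ,
      h.toLp = ((kernelOp P hP * kernelOp K hK) ^ k) hg.toLp := by
  induction k with
  | zero => exact ⟨hg, rfl⟩
  | succ k ih =>
    obtain ⟨h, e⟩ := ih
    rw [Function.iterate_succ', pow_succ', mul_apply_eq_comp, ← e, mul_apply_eq_comp,
      kernelOp_toLp, kernelOp_toLp]
    exact ⟨memLp_act hP (memLp_act hK h), rfl⟩

theorem memLp_centered {f : E → ℝ} (hf : MemLp f 2 μ) : MemLp (centered μ f) 2 μ :=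
  hf.sub (memLp_const _)

theorem memLp_centered_add (hP : P.Invariant μ) {f : E → ℝ} (hf : MemLp f 2 μ) (lam : ℝ) :
    MemLp (fun y => centered μ f y + lam * act P (centered μ f) y) 2 μ :=
  (memLp_centered hf).add ((memLp_act hP (memLp_centered hf)).const_mul lam)

theorem integrable_cycleIntegrand (hP : P.Invariant μ) (hK : K.Invariant μ) {f : E → ℝ}
    (hf : MemLp f 2 μ) (lam : ℝ) (k : ℕ) : Integrable (cycleIntegrand μ lam f P K k) μ :=
  (memLp_centered hf).integrable_mul
    (exists_memLp_iterate_act hP hK (memLp_centered_add hP hf lam) k).1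

theorem cycleTerm_eq (hP : P.Invariant μ) (hK : K.Invariant μ) {f : E → ℝ}
    (hf : MemLp f 2 μ) (lam : ℝ) (k : ℕ) :
    cycleTerm μ lam f P K k = lam ^ (2 * k) *
      inner ℝ (memLp_centered hf).toLp (((kernelOp P hP * kernelOp K hK) ^ k)
        ((memLp_centered hf).toLp + lam • kernelOp P hP (memLp_centered hf).toLp)) := by
  obtain ⟨h, e⟩ := exists_memLp_iterate_act hP hK (memLp_centered_add hP hf lam) k
  have e' : (memLp_centered_add hP hf lam).toLp =
      (memLp_centered hf).toLp + lam • kernelOp P hP (memLp_centered hf).toLp := by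
    rw [kernelOp_toLp, ← MemLp.toLp_const_smul, ← MemLp.toLp_add]
    rfl
  rw [← e', ← e, inner_toLp]
  rfl

theorem cycleTerm_eq_fst (hP : P.Invariant μ) (hK : K.Invariant μ) {f : E → ℝ}
    (hf : MemLp f 2 μ) (lam : ℝ) (k : ℕ) {F : Lp ℝ 2 μ} (hF : F = (memLp_centered hf).toLp) :
    cycleTerm μ lam f P K k =
      inner ℝ F (((lam • cycleOp (kernelOp P hP) (kernelOp K hK)) ^ (2 * k)) (F, F)).1 +
      inner ℝ F (((lam • cycleOp (kernelOp P hP) (kernelOp K hK)) ^ (2 * k + 1)) (F, F)).1 := by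
  rw [cycleTerm_eq hP hK hf, ← hF, smul_pow, smul_pow]
  simp only [smul_apply, cycleOp_pow_even, cycleOp_pow_odd, Prod.smul_fst,
    inner_smul_right, map_add, map_smul, inner_add_right]
  ring

theorem cycleTerm_eq_snd (hP : P.Invariant μ) (hK : K.Invariant μ) {f : E → ℝ}
    (hf : MemLp f 2 μ) (lam : ℝ) (k : ℕ) {F : Lp ℝ 2 μ} (hF : F = (memLp_centered hf).toLp) :
    cycleTerm μ lam f K P k =
      inner ℝ F (((lam • cycleOp (kernelOp P hP) (kernelOp K hK)) ^ (2 * k)) (F, F)).2 +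
      inner ℝ F (((lam • cycleOp (kernelOp P hP) (kernelOp K hK)) ^ (2 * k + 1)) (F, F)).2 := by
  rw [cycleTerm_eq hK hP hf, ← hF, smul_pow, smul_pow]
  simp only [smul_apply, cycleOp_pow_even, cycleOp_pow_odd, Prod.smul_snd,
    inner_smul_right, map_add, map_smul, inner_add_right]
  ring

theorem norm_cycleOp_kernelOp_le (hP : P.Invariant μ) (hK : K.Invariant μ) :
    ‖cycleOp (kernelOp P hP) (kernelOp K hK)‖ ≤ 1 :=
  norm_cycleOp_le (norm_kernelOp_le hP) (norm_kernelOp_le hK)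

/-- Groups the Neumann series in pairs, since one cycle term uses the powers 2k and 2k + 1. -/
theorem hasSum_even_add_odd {a : ℕ → ℝ} {s : ℝ} (ha : HasSum a s) :
    HasSum (fun k => a (2 * k) + a (2 * k + 1)) s := by
  have h₀ := ha.summable.comp_injective (mul_right_injective₀ (two_ne_zero (α := ℕ)))
  have h₁ := ha.summable.comp_injective
    ((add_left_injective 1).comp (mul_right_injective₀ (two_ne_zero (α := ℕ))))
  rw [← ha.tsum_eq, ← tsum_even_add_odd h₀ h₁]
  exact h₀.hasSum.add h₁.hasSum

theorem summable_cycleTerm (hP : P.Invariant μ) (hK : K.Invariant μ) {f : E → ℝ}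
    (hf : MemLp f 2 μ) {lam : ℝ} (h₀ : 0 ≤ lam) (h₁ : lam < 1) :
    Summable (cycleTerm μ lam f P K) := by
  have h := (hasSum_resolvent (norm_cycleOp_kernelOp_le hP hK) h₀ h₁
    ((innerSL ℝ (memLp_centered hf).toLp).comp (ContinuousLinearMap.fst ℝ _ _))
    ((memLp_centered hf).toLp, (memLp_centered hf).toLp))
  exact (hasSum_even_add_odd h).summable.congr fun k => (cycleTerm_eq_fst hP hK hf lam k rfl).symm

theorem cycleVarWellDefined (hP : P.Invariant μ) (hK : K.Invariant μ) {f : E → ℝ}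
    (hf : MemLp f 2 μ) {lam : ℝ} (h₀ : 0 ≤ lam) (h₁ : lam < 1) :
    CycleVarWellDefined μ lam f P K :=
  ⟨integrable_cycleIntegrand hP hK hf lam, integrable_cycleIntegrand hK hP hf lam,
    summable_cycleTerm hP hK hf h₀ h₁, summable_cycleTerm hK hP hf h₀ h₁⟩

/-- The asymptotic variance of a 2-cycle is a resolvent form of its block operator. -/
theorem cycleVar_eq (hP : P.Invariant μ) (hK : K.Invariant μ) {f : E → ℝ}
    (hf : MemLp f 2 μ) {lam : ℝ} (h₀ : 0 ≤ lam) (h₁ : lam < 1) {F : Lp ℝ 2 μ}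
    (hF : F = (memLp_centered hf).toLp) :
    cycleVar μ lam f P K =
      pairForm F (Ring.inverse (1 - lam • cycleOp (kernelOp P hP) (kernelOp K hK)) (F, F)) -
        ∫ z, centered μ f z ^ 2 ∂μ := by
  have h := hasSum_even_add_odd (hasSum_resolvent (X := Lp ℝ 2 μ × Lp ℝ 2 μ)
    (norm_cycleOp_kernelOp_le hP hK) h₀ h₁ (pairForm F) (F, F))
  rw [cycleVar, ← h.tsum_eq]
  congr 2
  funext k
  rw [cycleTerm_eq_fst hP hK hf lam k hF, cycleTerm_eq_snd hP hK hf lam k hF, pairForm_apply,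
    pairForm_apply]
  ring

/-- Ordering of the asymptotic variances of two 2-cycles with a common kernel. -/
theorem cycleVar_le {ξ : E → E} (hξ : IsIsometricInvolution μ ξ) {K₁ K₂ : Kernel E E}
    [IsMarkovKernel K₁] [IsMarkovKernel K₂] (hP : IsReversible μ ξ P) (hK₁ : IsReversible μ ξ K₁)
    (hK₂ : IsReversible μ ξ K₂)
    (hle : ∀ u : E → ℝ, StronglyMeasurable u → MemLp u 2 μ →
      ∫ z, flipOp ξ u z * act K₁ u z ∂μ ≤ ∫ z, flipOp ξ u z * act K₂ u z ∂μ)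
    {f : E → ℝ} (hf : MemLp f 2 μ) (hfξ : flipOp ξ f =ᵐ[μ] f) {lam : ℝ} (h₀ : 0 ≤ lam)
    (h₁ : lam < 1) : cycleVar μ lam f P K₁ ≤ cycleVar μ lam f P K₂ := by
  rw [cycleVar_eq hP.invariant hK₁.invariant hf h₀ h₁ rfl,
    cycleVar_eq hP.invariant hK₂.invariant hf h₀ h₁ rfl]
  refine sub_le_sub_right ?_ _
  refine pairForm_resolvent_mono (Q := flipL2 hξ.measurePreserving) (norm_kernelOp_le _)
    (norm_kernelOp_le _) (norm_kernelOp_le _) (inner_flipL2 hξ) (inner_flipL2_kernelOp hξ hP)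
    (inner_flipL2_kernelOp hξ hK₁) (inner_flipL2_kernelOp hξ hK₂) (fun x => ?_) ?_ h₀ h₁
  · have hx := Lp.memLp x
    rw [← Lp.toLp_coeFn x hx, flipL2_toLp, kernelOp_toLp, kernelOp_toLp, inner_toLp, inner_toLp]
    exact hle x (Lp.stronglyMeasurable x) hx
  · rw [flipL2_toLp]
    refine MemLp.toLp_congr _ _ ?_
    filter_upwards [hfξ] with z hz
    simp only [flipOp, centered] at hz ⊢
    rw [hz]

end CycleVariance

/-! ### Acceptance functions and their maximal element. -/

section Acceptance

theorem isAcceptance_min : IsAcceptance fun r => min 1 r where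
  measurable := measurable_const.min measurable_id
  le_one r := min_le_left _ _
  balance r hr := by
    rw [mul_min_of_nonneg _ _ hr.le, mul_one, mul_inv_cancel₀ hr.ne', min_comm]
  map_zero := by simp

theorem IsAcceptance.le_min_one_self {φ : ℝ≥0 → ℝ≥0} (hφ : IsAcceptance φ) (r : ℝ≥0) :
    φ r ≤ min 1 r := by
  refine _root_.le_min (hφ.le_one r) ?_
  rcases eq_zero_or_pos r with rfl | hr
  · exact hφ.map_zero.le
  · rw [← hφ.balance r hr]
    exact mul_le_of_le_one_right' (hφ.le_one _)

/-- The two-point balance `x φ(y / x) = y φ(x / y)`. -/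
theorem IsAcceptance.mul_div {φ : ℝ≥0 → ℝ≥0} (hφ : IsAcceptance φ) {x y : ℝ≥0} (hx : 0 < x)
    (hy : 0 < y) : x * φ (y / x) = y * φ (x / y) := by
  rw [← hφ.balance (y / x) (div_pos hy hx), inv_div, ← mul_assoc, mul_div_cancel₀ _ hx.ne']

end Acceptance

/-! ### Detailed balance and the quadratic form of metropolized flows. -/

section Flow

variable {E : Type*} [MeasurableSpace E] {μ : Measure E} {ξ ψ : E → E}

theorem integral_comp_of_stronglyMeasurable {ν : Measure E} {T : E → E}
    (hT : MeasurePreserving T ν ν) {v : E → ℝ} (hv : StronglyMeasurable v) :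
    ∫ z, v (T z) ∂ν = ∫ z, v z ∂ν := by
  conv_rhs => rw [← hT.map_eq, integral_map hT.measurable.aemeasurable hv.aestronglyMeasurable]

theorem map_withDensity_involutive {ν : Measure E} {T : E → E} (hT : MeasurePreserving T ν ν)
    (hi : Function.Involutive T) {g : E → ℝ≥0∞} (hg : Measurable g) :
    (ν.withDensity g).map T = ν.withDensity (g ∘ T) := by
  ext s hs
  rw [Measure.map_apply hT.measurable hs, withDensity_apply _ (hT.measurable hs),
    withDensity_apply _ hs, ← hT.setLIntegral_comp_preimage hs (hg.comp hT.measurable)]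
  simp only [Function.comp_apply, hi _]

/-- The part of `μ` on which the move of the metropolized flow is accepted. -/
noncomputable def acceptedMeasure (μ : Measure E) (ξ ψ : E → E) (φ : ℝ≥0 → ℝ≥0) : Measure E :=
  μ.withDensity fun z => (φ (ratio μ ξ ψ z) : ℝ≥0∞)

variable {φ : ℝ≥0 → ℝ≥0}

theorem acceptedMeasure_mono {φ' : ℝ≥0 → ℝ≥0} (h : ∀ r, φ' r ≤ φ r) :
    acceptedMeasure μ ξ ψ φ' ≤ acceptedMeasure μ ξ ψ φ :=
  withDensity_mono (.of_forall fun _ => ENNReal.coe_le_coe.2 (h _))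

theorem acceptedMeasure_le (hφ : IsAcceptance φ) : acceptedMeasure μ ξ ψ φ ≤ μ := by
  conv_rhs => rw [← withDensity_one (μ := μ)]
  exact withDensity_mono (.of_forall fun z => by simpa using hφ.le_one _)

/-- Detailed balance: the accepted part of `μ` is invariant under the involution `ξ ∘ ψ`. -/
theorem measurePreserving_acceptedMeasure [IsFiniteMeasure μ] (hξ : Measurable ξ)
    (hψ : IsTimeReversible ξ ψ) (hφ : IsAcceptance φ) :
    MeasurePreserving (ξ ∘ ψ) (acceptedMeasure μ ξ ψ φ) (acceptedMeasure μ ξ ψ φ) := by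
  set T := ξ ∘ ψ
  have hTm : Measurable T := hξ.comp hψ.measurable
  have hi : Function.Involutive T := fun z => hψ.left_inv z
  set ν := μ + μ.map T with hν
  -- T is an involution, so it swaps the two summands of ν.
  have hTν : MeasurePreserving T ν ν := by
    refine ⟨hTm, ?_⟩
    rw [hν, Measure.map_add _ _ hTm, Measure.map_map hTm hTm, hi.comp_self, Measure.map_id,
      add_comm]
  set a := μ.rnDeriv ν
  set b := (μ.map T).rnDeriv ν
  have ham : Measurable a := Measure.measurable_rnDeriv _ _
  have hbm : Measurable b := Measure.measurable_rnDeriv _ _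
  have hμa : ν.withDensity a = μ :=
    Measure.withDensity_rnDeriv_eq _ _
      (Measure.absolutelyContinuous_of_le (Measure.le_add_right le_rfl))
  have hμb : ν.withDensity b = μ.map T :=
    Measure.withDensity_rnDeriv_eq _ _
      (Measure.absolutelyContinuous_of_le (Measure.le_add_left le_rfl))
  -- T carries aν = μ to (a ∘ T)ν, which must also be bν; densities are unique almost everywhere.
  -- Thus T exchanges a and b and inverts the ratio.
  have hab : a ∘ T =ᵐ[ν] b := by
    rw [← withDensity_eq_iff_of_sigmaFinite (ham.comp hTm).aemeasurable hbm.aemeasurable,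
      ← map_withDensity_involutive hTν hi ham, hμa, hμb]
  have hba : b ∘ T =ᵐ[ν] a := by
    have := hTν.quasiMeasurePreserving.ae_eq_comp hab
    rw [Function.comp_assoc, hi.comp_self, Function.comp_id] at this
    exact this.symm
  have hr : Measurable fun z => (φ (ratio μ ξ ψ z) : ℝ≥0∞) :=
    (hφ.measurable.comp (measurable_ratio μ ξ ψ)).coe_nnreal_ennreal
  have hm : acceptedMeasure μ ξ ψ φ = ν.withDensity (a * fun z => (φ (ratio μ ξ ψ z) : ℝ≥0∞)) := by
    rw [withDensity_mul _ ham hr, hμa]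
    rfl
  refine ⟨hTm, ?_⟩
  rw [hm, map_withDensity_involutive hTν hi (ham.mul hr)]
  refine withDensity_congr_ae ?_
  filter_upwards [hab, hba, μ.rnDeriv_lt_top ν, (μ.map T).rnDeriv_lt_top ν] with z h₁ h₂ h₃ h₄
  simp only [Function.comp_apply] at h₁ h₂
  have e₁ : ratio μ ξ ψ z = if 0 < b z ∧ 0 < a z then (b z).toNNReal / (a z).toNNReal else 0 := rfl
  have e₂ : ratio μ ξ ψ (T z) =
      if 0 < a z ∧ 0 < b z then (a z).toNNReal / (b z).toNNReal else 0 := by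
    rw [← h₁, ← h₂]
    rfl
  simp only [Function.comp_apply, Pi.mul_apply]
  rw [e₁, e₂, h₁]
  by_cases hpos : 0 < a z ∧ 0 < b z
  · rw [if_pos hpos, if_pos hpos.symm]
    have hx := ENNReal.toNNReal_pos hpos.1.ne' h₃.ne
    have hy := ENNReal.toNNReal_pos hpos.2.ne' h₄.ne
    have := hφ.mul_div hx hy
    have this := congrArg ((↑) : ℝ≥0 → ℝ≥0∞) this
    rw [ENNReal.coe_mul, ENNReal.coe_mul, ENNReal.coe_toNNReal h₃.ne,
      ENNReal.coe_toNNReal h₄.ne] at this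
    exact this.symm
  -- Where a density vanishes, the ratio is 0 at both z and T z, and φ(0) = 0 rejects the move.
  · rw [if_neg hpos, if_neg fun h => hpos h.symm, hφ.map_zero]
    simp

instance isMarkovKernel_metropolizedFlow (hξ : Measurable ξ) (hψ : Measurable ψ)
    (hφ : IsAcceptance φ) : IsMarkovKernel (metropolizedFlow μ ξ ψ φ hξ hψ hφ.measurable) := by
  refine ⟨fun z => ⟨?_⟩⟩
  change ((φ (ratio μ ξ ψ z) : ℝ≥0∞) • Measure.dirac (ψ z) +
    (1 - (φ (ratio μ ξ ψ z) : ℝ≥0∞)) • Measure.dirac (ξ z)) Set.univ = 1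
  simp only [Measure.add_apply, Measure.smul_apply, measure_univ, smul_eq_mul, mul_one]
  exact add_tsub_cancel_of_le (by simpa using hφ.le_one _)

/-- Since ξ² = id, u(ψ z) = (Qu)(T z), so the kernel can be written using only Qu and the involution
T. -/
theorem act_metropolizedFlow (hξ : Measurable ξ) (hi : Function.Involutive ξ) (hψ : Measurable ψ)
    (hφ : IsAcceptance φ) {u : E → ℝ} (hu : StronglyMeasurable u) (z : E) :
    act (metropolizedFlow μ ξ ψ φ hξ hψ hφ.measurable) u z =
      φ (ratio μ ξ ψ z) • flipOp ξ u ((ξ ∘ ψ) z) + flipOp ξ u z -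
        φ (ratio μ ξ ψ z) • flipOp ξ u z := by
  have hint (c : ℝ≥0∞) (hc : c ≠ ∞) (x : E) : Integrable u (c • Measure.dirac x) :=
    (integrable_dirac' hu (by simp)).smul_measure hc
  change ∫ y, u y ∂((φ (ratio μ ξ ψ z) : ℝ≥0∞) • Measure.dirac (ψ z) +
    (1 - (φ (ratio μ ξ ψ z) : ℝ≥0∞)) • Measure.dirac (ξ z)) = _
  rw [integral_add_measure (hint _ ENNReal.coe_ne_top _)
    (hint _ (ENNReal.sub_ne_top ENNReal.one_ne_top) _), integral_smul_measure,
    integral_smul_measure, integral_dirac' _ _ hu, integral_dirac' _ _ hu,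
    ENNReal.toReal_sub_of_le (by simpa using hφ.le_one _) ENNReal.one_ne_top]
  simp only [flipOp, Function.comp_apply, hi _, ENNReal.coe_toReal, ENNReal.toReal_one,
    smul_eq_mul, NNReal.smul_def]
  ring

theorem integral_act_metropolizedFlow_mul [IsFiniteMeasure μ] (hξ : IsIsometricInvolution μ ξ)
    (hψ : IsTimeReversible ξ ψ) (hφ : IsAcceptance φ) {u g : E → ℝ} (hu : StronglyMeasurable u)
    (hu₂ : MemLp u 2 μ) (hg₂ : MemLp g 2 μ) :
    ∫ z, act (metropolizedFlow μ ξ ψ φ hξ.measurable hψ.measurable hφ.measurable) u z * g z ∂μ =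
      ∫ z, flipOp ξ u ((ξ ∘ ψ) z) * g z ∂(acceptedMeasure μ ξ ψ φ) +
        ∫ z, flipOp ξ u z * g z ∂μ - ∫ z, flipOp ξ u z * g z ∂(acceptedMeasure μ ξ ψ φ) := by
  have hle := acceptedMeasure_le (μ := μ) (ξ := ξ) (ψ := ψ) hφ
  have hT := measurePreserving_acceptedMeasure (μ := μ) hξ.measurable hψ hφ
  have hh := memLp_flipOp hξ.measurePreserving hu₂
  have hφm : Measurable fun z => φ (ratio μ ξ ψ z) := hφ.measurable.comp (measurable_ratio μ ξ ψ)
  have i₁ : Integrable (fun z => flipOp ξ u ((ξ ∘ ψ) z) * g z) (acceptedMeasure μ ξ ψ φ) :=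
    ((hh.mono_measure hle).comp_measurePreserving hT).integrable_mul (hg₂.mono_measure hle)
  have i₂ : Integrable (fun z => flipOp ξ u z * g z) μ := hh.integrable_mul hg₂
  have i₃ : Integrable (fun z => flipOp ξ u z * g z) (acceptedMeasure μ ξ ψ φ) :=
    i₂.mono_measure hle
  have e (v : E → ℝ) : ∫ z, v z ∂(acceptedMeasure μ ξ ψ φ) =
      ∫ z, φ (ratio μ ξ ψ z) • v z ∂μ := integral_withDensity_eq_integral_smul hφm v
  have ei (v : E → ℝ) : Integrable v (acceptedMeasure μ ξ ψ φ) ↔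
      Integrable (fun z => φ (ratio μ ξ ψ z) • v z) μ :=
    integrable_withDensity_iff_integrable_smul hφm
  rw [ei] at i₁ i₃
  have i₁₂ : Integrable (fun z => φ (ratio μ ξ ψ z) • (flipOp ξ u ((ξ ∘ ψ) z) * g z) +
      flipOp ξ u z * g z) μ := i₁.add i₂
  rw [e, e, ← integral_add i₁ i₂, ← integral_sub i₁₂ i₃]
  refine integral_congr_ae (.of_forall fun z => ?_)
  simp only [act_metropolizedFlow hξ.measurable hξ.involutive hψ.measurable hφ hu, NNReal.smul_def,
    smul_eq_mul]
  ring

/-- Composition with a measure-preserving involution is symmetric: change variables by T and cancel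
T ∘ T. -/
theorem integral_comp_mul_acceptedMeasure [IsFiniteMeasure μ] (hξ : Measurable ξ)
    (hψ : IsTimeReversible ξ ψ) (hφ : IsAcceptance φ) {u g : E → ℝ}
    (hu : StronglyMeasurable u) (hg : StronglyMeasurable g) :
    ∫ z, u ((ξ ∘ ψ) z) * g z ∂(acceptedMeasure μ ξ ψ φ) =
      ∫ z, u z * g ((ξ ∘ ψ) z) ∂(acceptedMeasure μ ξ ψ φ) := by
  have hT := measurePreserving_acceptedMeasure (μ := μ) hξ hψ hφ
  have hi : Function.Involutive (ξ ∘ ψ) := fun z => hψ.left_inv z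
  have hm : StronglyMeasurable fun z => u ((ξ ∘ ψ) z) * g z :=
    (hu.comp_measurable hT.measurable).mul hg
  rw [← integral_comp_of_stronglyMeasurable hT hm]
  simp only [hi _]

theorem isReversible_metropolizedFlow [IsProbabilityMeasure μ] (hξ : IsIsometricInvolution μ ξ)
    (hψ : IsTimeReversible ξ ψ) (hφ : IsAcceptance φ) :
    IsReversible μ ξ (metropolizedFlow μ ξ ψ φ hξ.measurable hψ.measurable hφ.measurable) := by
  have := isMarkovKernel_metropolizedFlow (μ := μ) hξ.measurable hψ.measurable hφ
  refine isReversible_of_stronglyMeasurable hξ.measurePreserving fun f g hf hg hf₂ hg₂ => ?_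
  have hf' : StronglyMeasurable (flipOp ξ f) := hf.comp_measurable hξ.measurable
  have hg' : StronglyMeasurable (flipOp ξ g) := hg.comp_measurable hξ.measurable
  have hgg : flipOp ξ (flipOp ξ g) = g := funext fun z => by simp only [flipOp, hξ.involutive z]
  have hQf₂ := memLp_flipOp hξ.measurePreserving hf₂
  have hQg₂ := memLp_flipOp hξ.measurePreserving hg₂
  -- Changing variables by ξ gives the right side the shape of the left one, with (Qg, Qf) in place
  -- of (f, g).
  have hright : ∫ z, f z * flipOp ξ (act (metropolizedFlow μ ξ ψ φ hξ.measurable hψ.measurable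
      hφ.measurable) (flipOp ξ g)) z ∂μ = ∫ z, act (metropolizedFlow μ ξ ψ φ hξ.measurable
        hψ.measurable hφ.measurable) (flipOp ξ g) z * flipOp ξ f z ∂μ := by
    have hm : StronglyMeasurable fun z => f z * flipOp ξ (act (metropolizedFlow μ ξ ψ φ
        hξ.measurable hψ.measurable hφ.measurable) (flipOp ξ g)) z :=
      hf.mul ((stronglyMeasurable_act hg').comp_measurable hξ.measurable)
    rw [← integral_comp_of_stronglyMeasurable hξ.measurePreserving hm]
    refine integral_congr_ae (.of_forall fun z => ?_)
    simp only [flipOp, hξ.involutive z]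
    ring
  rw [hright, integral_act_metropolizedFlow_mul hξ hψ hφ hf hf₂ hg₂,
    integral_act_metropolizedFlow_mul hξ hψ hφ hg' hQg₂ hQf₂, hgg,
    integral_comp_mul_acceptedMeasure hξ.measurable hψ hφ hf' hg]
  simp only [mul_comm]

/-- The quadratic form of `Q P_φ` in terms of the accepted part of `μ`. -/
theorem integral_flipOp_mul_act_metropolizedFlow [IsFiniteMeasure μ]
    (hξ : IsIsometricInvolution μ ξ) (hψ : IsTimeReversible ξ ψ) (hφ : IsAcceptance φ)
    {u : E → ℝ} (hu : StronglyMeasurable u) (hu₂ : MemLp u 2 μ) :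
    ∫ z, flipOp ξ u z *
        act (metropolizedFlow μ ξ ψ φ hξ.measurable hψ.measurable hφ.measurable) u z ∂μ =
      ∫ z, flipOp ξ u z ^ 2 ∂μ -
        2⁻¹ * ∫ z, (flipOp ξ u ((ξ ∘ ψ) z) - flipOp ξ u z) ^ 2 ∂(acceptedMeasure μ ξ ψ φ) := by
  have hle := acceptedMeasure_le (μ := μ) (ξ := ξ) (ψ := ψ) hφ
  have hT := measurePreserving_acceptedMeasure (μ := μ) hξ.measurable hψ hφ
  have hh := memLp_flipOp hξ.measurePreserving hu₂
  have hh₁ := hh.mono_measure hle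
  have hh₂ := hh₁.comp_measurePreserving hT
  have hm : StronglyMeasurable fun z => flipOp ξ u z ^ 2 :=
    (hu.comp_measurable hξ.measurable).pow 2
  have hsq : ∫ z, flipOp ξ u ((ξ ∘ ψ) z) ^ 2 ∂(acceptedMeasure μ ξ ψ φ) =
      ∫ z, flipOp ξ u z ^ 2 ∂(acceptedMeasure μ ξ ψ φ) :=
    integral_comp_of_stronglyMeasurable hT hm
  have hexp : ∫ z, (flipOp ξ u ((ξ ∘ ψ) z) - flipOp ξ u z) ^ 2 ∂(acceptedMeasure μ ξ ψ φ) =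
      ∫ z, flipOp ξ u ((ξ ∘ ψ) z) ^ 2 ∂(acceptedMeasure μ ξ ψ φ) +
      ∫ z, flipOp ξ u z ^ 2 ∂(acceptedMeasure μ ξ ψ φ) -
      2 * ∫ z, flipOp ξ u ((ξ ∘ ψ) z) * flipOp ξ u z ∂(acceptedMeasure μ ξ ψ φ) := by
    have i₁ : Integrable (fun z => flipOp ξ u ((ξ ∘ ψ) z) ^ 2) (acceptedMeasure μ ξ ψ φ) :=
      hh₂.integrable_sq
    have i₁₂ : Integrable (fun z => flipOp ξ u ((ξ ∘ ψ) z) ^ 2 + flipOp ξ u z ^ 2)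
      (acceptedMeasure μ ξ ψ φ) := i₁.add hh₁.integrable_sq
    have i₃ : Integrable (fun z => 2 * (flipOp ξ u ((ξ ∘ ψ) z) * flipOp ξ u z))
      (acceptedMeasure μ ξ ψ φ) := (hh₂.integrable_mul hh₁).const_mul 2
    rw [← integral_const_mul, ← integral_add i₁ hh₁.integrable_sq, ← integral_sub i₁₂ i₃]
    refine integral_congr_ae (.of_forall fun z => ?_)
    ring
  simp only [mul_comm (flipOp ξ u _) (act _ _ _)]
  rw [integral_act_metropolizedFlow_mul hξ hψ hφ hu hu₂ hh, hexp, hsq]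
  simp only [← pow_two]
  ring

theorem integral_flipOp_mul_act_metropolizedFlow_le [IsFiniteMeasure μ]
    (hξ : IsIsometricInvolution μ ξ) (hψ : IsTimeReversible ξ ψ) {φ₁ φ₂ : ℝ≥0 → ℝ≥0}
    (hφ₁ : IsAcceptance φ₁) (hφ₂ : IsAcceptance φ₂) (hle : ∀ r, φ₂ r ≤ φ₁ r)
    {u : E → ℝ} (hu : StronglyMeasurable u) (hu₂ : MemLp u 2 μ) :
    ∫ z, flipOp ξ u z *
        act (metropolizedFlow μ ξ ψ φ₁ hξ.measurable hψ.measurable hφ₁.measurable) u z ∂μ ≤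
      ∫ z, flipOp ξ u z *
        act (metropolizedFlow μ ξ ψ φ₂ hξ.measurable hψ.measurable hφ₂.measurable) u z ∂μ := by
  rw [integral_flipOp_mul_act_metropolizedFlow hξ hψ hφ₁ hu hu₂,
    integral_flipOp_mul_act_metropolizedFlow hξ hψ hφ₂ hu hu₂]
  have hh := (memLp_flipOp hξ.measurePreserving hu₂).mono_measure
    (acceptedMeasure_le (ξ := ξ) (ψ := ψ) hφ₁)
  have hT := measurePreserving_acceptedMeasure (μ := μ) hξ.measurable hψ hφ₁
  have : ∫ z, (flipOp ξ u ((ξ ∘ ψ) z) - flipOp ξ u z) ^ 2 ∂(acceptedMeasure μ ξ ψ φ₂) ≤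
      ∫ z, (flipOp ξ u ((ξ ∘ ψ) z) - flipOp ξ u z) ^ 2 ∂(acceptedMeasure μ ξ ψ φ₁) :=
    integral_mono_measure (acceptedMeasure_mono hle) (.of_forall fun z => sq_nonneg _)
      ((hh.comp_measurePreserving hT).sub hh).integrable_sq
  linarith

theorem cycleVarWellDefined_metropolizedFlow [IsProbabilityMeasure μ]
    (hξ : IsIsometricInvolution μ ξ) (hψ : IsTimeReversible ξ ψ) {P : Kernel E E}
    [IsMarkovKernel P] (hP : IsReversible μ ξ P) {f : E → ℝ} (hf : MemLp f 2 μ) {lam : ℝ}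
    (h₀ : 0 ≤ lam) (h₁ : lam < 1) (hφ : IsAcceptance φ) :
    CycleVarWellDefined μ lam f P
      (metropolizedFlow μ ξ ψ φ hξ.measurable hψ.measurable hφ.measurable) := by
  have := isMarkovKernel_metropolizedFlow (μ := μ) hξ.measurable hψ.measurable hφ
  exact cycleVarWellDefined hP.invariant (isReversible_metropolizedFlow hξ hψ hφ).invariant
    hf h₀ h₁

theorem cycleVar_metropolizedFlow_le [IsProbabilityMeasure μ]
    (hξ : IsIsometricInvolution μ ξ) (hψ : IsTimeReversible ξ ψ) {P : Kernel E E}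
    [IsMarkovKernel P] (hP : IsReversible μ ξ P) {f : E → ℝ} (hf : MemLp f 2 μ)
    (hfξ : flipOp ξ f =ᵐ[μ] f) {lam : ℝ} (h₀ : 0 ≤ lam) (h₁ : lam < 1) {φ₁ φ₂ : ℝ≥0 → ℝ≥0}
    (hφ₁ : IsAcceptance φ₁) (hφ₂ : IsAcceptance φ₂) (hle : ∀ r, φ₂ r ≤ φ₁ r) :
    cycleVar μ lam f P
        (metropolizedFlow μ ξ ψ φ₁ hξ.measurable hψ.measurable hφ₁.measurable) ≤
      cycleVar μ lam f P
        (metropolizedFlow μ ξ ψ φ₂ hξ.measurable hψ.measurable hφ₂.measurable) := by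
  have := isMarkovKernel_metropolizedFlow (μ := μ) hξ.measurable hψ.measurable hφ₁
  have := isMarkovKernel_metropolizedFlow (μ := μ) hξ.measurable hψ.measurable hφ₂
  exact cycleVar_le hξ hP (isReversible_metropolizedFlow hξ hψ hφ₁)
    (isReversible_metropolizedFlow hξ hψ hφ₂)
    (fun u hu hu₂ => integral_flipOp_mul_act_metropolizedFlow_le hξ hψ hφ₁ hφ₂ hle hu hu₂)
    hf hfξ h₀ h₁

end Flow

/-! ### Partial momentum refreshment and Gaussian rotations. -/

section Refreshment

theorem measurePreserving_momentumFlip (π : Measure ℝ) [IsProbabilityMeasure π] (s : ℝ≥0) :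
    MeasurePreserving momentumFlip (π.prod (gaussianReal 0 s)) (π.prod (gaussianReal 0 s)) := by
  have h : MeasurePreserving (fun v : ℝ => -v) (gaussianReal 0 s) (gaussianReal 0 s) :=
    ⟨measurable_neg, by rw [gaussianReal_map_neg, neg_zero]⟩
  exact (MeasurePreserving.id π).prod h

theorem isIsometricInvolution_momentumFlip (π : Measure ℝ) [IsProbabilityMeasure π] (s : ℝ≥0) :
    IsIsometricInvolution (π.prod (gaussianReal 0 s)) momentumFlip where
  measurable := (measurePreserving_momentumFlip π s).measurable
  involutive z := by simp [momentumFlip]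
  isometry f g hf hg := by
    have hm := measurePreserving_momentumFlip π s
    have hfg : AEStronglyMeasurable (fun z => f z * g z)
      ((π.prod (gaussianReal 0 s)).map momentumFlip) := by
      rw [hm.map_eq]
      exact hf.1.mul hg.1
    exact (integral_map hm.measurable.aemeasurable hfg).symm.trans (by rw [hm.map_eq])

instance isMarkovKernel_refreshment (s : ℝ≥0) (ω : ℝ) : IsMarkovKernel (refreshment s ω) := by
  refine ⟨fun z => ?_⟩
  exact Measure.isProbabilityMeasure_map (by fun_prop)

theorem act_refreshment (s : ℝ≥0) (ω : ℝ) {f : ℝ × ℝ → ℝ} (hf : StronglyMeasurable f)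
    (z : ℝ × ℝ) : act (refreshment s ω) f z =
      ∫ v', f (z.1, z.2 * Real.cos ω + v' * Real.sin ω) ∂(gaussianReal 0 s) :=
  integral_map (by fun_prop) hf.aestronglyMeasurable

/-- The rotation of the old and the fresh momentum. -/
noncomputable def momentumRotation (ω : ℝ) (q : (ℝ × ℝ) × ℝ) : (ℝ × ℝ) × ℝ :=
  ((q.1.1, q.1.2 * Real.cos ω + q.2 * Real.sin ω), q.2 * Real.cos ω - q.1.2 * Real.sin ω)

theorem measurePreserving_momentumRotation (π : Measure ℝ) [IsProbabilityMeasure π] (s : ℝ≥0)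
    (ω : ℝ) :
    MeasurePreserving (momentumRotation ω) ((π.prod (gaussianReal 0 s)).prod (gaussianReal 0 s))
      ((π.prod (gaussianReal 0 s)).prod (gaussianReal 0 s)) := by
  have h : MeasurePreserving (ContinuousLinearMap.rotation (E := ℝ) ω)
      ((gaussianReal 0 s).prod (gaussianReal 0 s)) ((gaussianReal 0 s).prod (gaussianReal 0 s)) :=
    ⟨(ContinuousLinearMap.rotation (E := ℝ) ω).continuous.measurable,
      IsGaussian.map_rotation_eq_self (by simp) ω⟩
  have hA := measurePreserving_prodAssoc π (gaussianReal 0 s) (gaussianReal 0 s)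
  have := (hA.symm _).comp (((MeasurePreserving.id π).prod h).comp hA)
  convert this using 1
  funext q
  simp only [momentumRotation, Function.comp_apply, MeasurableEquiv.prodAssoc, Prod.map,
    ContinuousLinearMap.rotation_apply, smul_eq_mul, id]
  change _ = ((q.1.1, Real.cos ω * q.1.2 + Real.sin ω * q.2),
    -Real.sin ω * q.1.2 + Real.cos ω * q.2)
  ext
  · rfl
  · simp only; ring
  · simp only; ring

/-- Adjoin the fresh momentum as a coordinate. The left side is the integral of f(rotated point)
g(old point); rotating back moves the inverse rotation onto g, and replacing the angle ω by -ω is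
what conjugation by Q does. -/
theorem isReversible_refreshment (π : Measure ℝ) [IsProbabilityMeasure π] (s : ℝ≥0) (ω : ℝ) :
    IsReversible (π.prod (gaussianReal 0 s)) momentumFlip (refreshment s ω) := by
  refine isReversible_of_stronglyMeasurable (measurePreserving_momentumFlip π s)
    fun f g hf hg hf₂ hg₂ => ?_
  have hgQ : StronglyMeasurable (flipOp momentumFlip g) :=
    hg.comp_measurable (measurePreserving_momentumFlip π s).measurable
  have hrot := measurePreserving_momentumRotation π s ω
  have hfst : MeasurePreserving (Prod.fst : (ℝ × ℝ) × ℝ → ℝ × ℝ)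
    ((π.prod (gaussianReal 0 s)).prod (gaussianReal 0 s)) (π.prod (gaussianReal 0 s)) :=
    measurePreserving_fst
  have i₁ : Integrable (fun q : (ℝ × ℝ) × ℝ => f (momentumRotation ω q).1 * g q.1)
      ((π.prod (gaussianReal 0 s)).prod (gaussianReal 0 s)) :=
    (hf₂.comp_measurePreserving (hfst.comp hrot)).integrable_mul
      (hg₂.comp_measurePreserving hfst)
  set Ψ : (ℝ × ℝ) × ℝ → ℝ := fun q =>
    f q.1 * g (q.1.1, q.1.2 * Real.cos ω - q.2 * Real.sin ω) with hΨ
  have hΨm : StronglyMeasurable Ψ :=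
    (hf.comp_measurable measurable_fst).mul (hg.comp_measurable (by fun_prop))
  have e : ∀ q, Ψ (momentumRotation ω q) = f (momentumRotation ω q).1 * g q.1 := by
    intro q
    have : (q.1.2 * Real.cos ω + q.2 * Real.sin ω) * Real.cos ω -
        (q.2 * Real.cos ω - q.1.2 * Real.sin ω) * Real.sin ω = q.1.2 := by
      linear_combination q.1.2 * Real.sin_sq_add_cos_sq ω
    simp only [hΨ, momentumRotation, this]
  have i₂ : Integrable Ψ ((π.prod (gaussianReal 0 s)).prod (gaussianReal 0 s)) := by
    rw [← hrot.integrable_comp hΨm.aestronglyMeasurable]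
    exact i₁.congr (.of_forall fun q => (e q).symm)
  have hl : ∫ z, act (refreshment s ω) f z * g z ∂(π.prod (gaussianReal 0 s)) =
      ∫ q, f (momentumRotation ω q).1 * g q.1
        ∂((π.prod (gaussianReal 0 s)).prod (gaussianReal 0 s)) := by
    rw [integral_prod _ i₁]
    refine integral_congr_ae (.of_forall fun z => ?_)
    simp only [act_refreshment s ω hf, integral_mul_const, momentumRotation]
  have hr : ∫ z, f z * flipOp momentumFlip (act (refreshment s ω) (flipOp momentumFlip g)) z
      ∂(π.prod (gaussianReal 0 s)) =
      ∫ q, Ψ q ∂((π.prod (gaussianReal 0 s)).prod (gaussianReal 0 s)) := by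
    rw [integral_prod _ i₂]
    refine integral_congr_ae (.of_forall fun z => ?_)
    simp only [hΨ, integral_const_mul]
    congr 1
    rw [flipOp, act_refreshment s ω hgQ]
    refine integral_congr_ae (.of_forall fun v => ?_)
    simp only [flipOp, momentumFlip]
    congr 2
    ring
  rw [hl, hr, ← integral_comp_of_stronglyMeasurable hrot hΨm]
  simp only [e]

end Refreshment

/-! ### Time reversibility of the Störmer–Verlet map. -/

section Verlet

variable {p : ℝ → ℝ} {s : ℝ≥0}

/-- Position and momentum separate, so each partial derivative involves one coordinate and kick and
drift are explicit shears. -/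
theorem hamiltonian_eq (hp : ∀ x, 0 < p x) (hs : 0 < s) (x v : ℝ) :
    hamiltonian p s (x, v) =
      -Real.log (p x) + (v ^ 2 / (2 * s) - Real.log (√(2 * Real.pi * s))⁻¹) := by
  have hc : (√(2 * Real.pi * s))⁻¹ ≠ 0 := by positivity
  rw [hamiltonian, gaussianPDFReal, Real.log_mul (hp x).ne' (by positivity),
    Real.log_mul hc (Real.exp_pos _).ne', Real.log_exp]
  simp only [sub_zero]
  ring

theorem kick_hamiltonian (hp : ∀ x, 0 < p x) (hd : Differentiable ℝ p) (hs : 0 < s) (t : ℝ)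
    (z : ℝ × ℝ) : kick (hamiltonian p s) t z = (z.1, z.2 + t * (deriv p z.1 / p z.1)) := by
  have : deriv (fun y => hamiltonian p s (y, z.2)) z.1 = -(deriv p z.1 / p z.1) := by
    simp only [hamiltonian_eq hp hs]
    exact (((hd z.1).hasDerivAt.log (hp z.1).ne').neg.add_const _).deriv
  rw [kick, this]
  simp

theorem drift_hamiltonian (hp : ∀ x, 0 < p x) (hs : 0 < s) (t : ℝ)
    (z : ℝ × ℝ) : drift (hamiltonian p s) t z = (z.1 + t * (z.2 / s), z.2) := by
  have : deriv (fun w => hamiltonian p s (z.1, w)) z.2 = z.2 / s := by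
    simp only [hamiltonian_eq hp hs]
    have h := ((((hasDerivAt_id z.2).pow 2).div_const (2 * (s : ℝ))).sub_const
      (Real.log (√(2 * Real.pi * s))⁻¹)).const_add (-Real.log (p z.1))
    refine h.deriv.trans ?_
    have : (s : ℝ) ≠ 0 := by exact_mod_cast hs.ne'
    simp only [id]
    field_simp
    norm_num
  rw [drift, this]

theorem verlet_hamiltonian (hp : ∀ x, 0 < p x) (hd : Differentiable ℝ p) (hs : 0 < s) (t : ℝ)
    (z : ℝ × ℝ) : verlet (hamiltonian p s) t z =
      (z.1 + t * ((z.2 + t / 2 * (deriv p z.1 / p z.1)) / s),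
        z.2 + t / 2 * (deriv p z.1 / p z.1) + t / 2 *
          (deriv p (z.1 + t * ((z.2 + t / 2 * (deriv p z.1 / p z.1)) / s)) /
            p (z.1 + t * ((z.2 + t / 2 * (deriv p z.1 / p z.1)) / s)))) := by
  simp only [verlet, Function.comp_apply, kick_hamiltonian hp hd hs, drift_hamiltonian hp hs]

/-- After the flip, the first half kick undoes the last one, the drift retraces its path from x' to
x, and the final half kick at x undoes the initial one. -/
theorem momentumFlip_verlet_involutive (hp : ∀ x, 0 < p x) (hd : Differentiable ℝ p) (hs : 0 < s)
    (t : ℝ) : Function.Involutive (momentumFlip ∘ verlet (hamiltonian p s) t) := by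
  rintro ⟨x, v⟩
  simp only [Function.comp_apply, verlet_hamiltonian hp hd hs, momentumFlip]
  set x' := x + t * ((v + t / 2 * (deriv p x / p x)) / s) with hx'
  have hx : x' + t * ((-(v + t / 2 * (deriv p x / p x) + t / 2 * (deriv p x' / p x')) +
      t / 2 * (deriv p x' / p x')) / s) = x := by
    rw [hx']
    ring
  rw [hx]
  ext
  · rfl
  · simp only
    ring

theorem isTimeReversible_verlet (hp : ∀ x, 0 < p x) (hd : Differentiable ℝ p) (hs : 0 < s)
    (t : ℝ) : IsTimeReversible momentumFlip (verlet (hamiltonian p s) t) where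
  measurable := by
    have h₁ : Measurable (kick (hamiltonian p s) (t / 2)) := by
      have : kick (hamiltonian p s) (t / 2) =
          fun z => (z.1, z.2 + t / 2 * (deriv p z.1 / p z.1)) :=
        funext (kick_hamiltonian hp hd hs _)
      rw [this]
      have hp' := hd.continuous.measurable
      have hp'' := measurable_deriv p
      fun_prop
    have h₂ : Measurable (drift (hamiltonian p s) t) := by
      have : drift (hamiltonian p s) t = fun z => (z.1 + t * (z.2 / s), z.2) :=
        funext (drift_hamiltonian hp hs _)
      rw [this]
      fun_prop
    exact h₁.comp (h₂.comp h₁)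
  left_inv := momentumFlip_verlet_involutive hp hd hs t
  -- The involution ξ ∘ ψ evaluated at ξ z gives ξψξψξ z = ξ z; cancel the outer ξ.
  right_inv z := by
    have h := momentumFlip_verlet_involutive hp hd hs t (momentumFlip z)
    have hi : Function.Involutive momentumFlip := fun z => by simp [momentumFlip]
    exact hi.injective h

end Verlet

end PeskunTierney


theorem mainTheorem4 :
    -- general 2-cycles
    (∀ (E : Type*) [MeasurableSpace E] (μ : Measure E) [IsProbabilityMeasure μ] (ξ ψ : E → E)
      (hξ : IsIsometricInvolution μ ξ) (hψ : IsTimeReversible ξ ψ)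
      (P : Kernel E E) [IsMarkovKernel P] (_ : IsReversible μ ξ P)
      (f : E → ℝ) (_ : MemLp f 2 μ) (_ : flipOp ξ f =ᵐ[μ] f)
      (lam : ℝ) (_ : 0 ≤ lam) (_ : lam < 1),
      (∀ (φ : ℝ≥0 → ℝ≥0) (hφ : IsAcceptance φ), CycleVarWellDefined μ lam f P
        (metropolizedFlow μ ξ ψ φ hξ.measurable hψ.measurable hφ.measurable)) ∧
      (∀ (φ₁ φ₂ : ℝ≥0 → ℝ≥0) (hφ₁ : IsAcceptance φ₁) (hφ₂ : IsAcceptance φ₂),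
        (∀ r, φ₂ r ≤ φ₁ r) →
        cycleVar μ lam f P
            (metropolizedFlow μ ξ ψ φ₁ hξ.measurable hψ.measurable hφ₁.measurable) ≤
          cycleVar μ lam f P
            (metropolizedFlow μ ξ ψ φ₂ hξ.measurable hψ.measurable hφ₂.measurable)) ∧
      (∃ hmin : IsAcceptance (fun r => min 1 r),
        ∀ (φ : ℝ≥0 → ℝ≥0) (hφ : IsAcceptance φ),
          cycleVar μ lam f P
              (metropolizedFlow μ ξ ψ (fun r => min 1 r) hξ.measurable hψ.measurable
                hmin.measurable) ≤
            cycleVar μ lam f P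
              (metropolizedFlow μ ξ ψ φ hξ.measurable hψ.measurable hφ.measurable))) ∧
    -- Hamiltonian Monte Carlo with partial momentum refreshment
    (∀ (π : Measure ℝ) [IsProbabilityMeasure π] (s : ℝ≥0) (_ : 0 < s)
      (ω : ℝ) (_ : 0 < ω) (_ : ω ≤ Real.pi / 2),
      ∃ hξ : IsIsometricInvolution (π.prod (gaussianReal 0 s)) momentumFlip,
        IsMarkovKernel (refreshment s ω) ∧
        IsReversible (π.prod (gaussianReal 0 s)) momentumFlip (refreshment s ω) ∧
        ∀ (ψ : ℝ × ℝ → ℝ × ℝ) (hψ : IsTimeReversible momentumFlip ψ)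
          (f : ℝ × ℝ → ℝ) (_ : MemLp f 2 (π.prod (gaussianReal 0 s)))
          (_ : flipOp momentumFlip f =ᵐ[π.prod (gaussianReal 0 s)] f)
          (lam : ℝ) (_ : 0 ≤ lam) (_ : lam < 1),
          (∀ (φ : ℝ≥0 → ℝ≥0) (hφ : IsAcceptance φ),
            CycleVarWellDefined (π.prod (gaussianReal 0 s)) lam f (refreshment s ω)
              (metropolizedFlow (π.prod (gaussianReal 0 s)) momentumFlip ψ φ hξ.measurable
                hψ.measurable hφ.measurable)) ∧
          (∀ (φ₁ φ₂ : ℝ≥0 → ℝ≥0) (hφ₁ : IsAcceptance φ₁) (hφ₂ : IsAcceptance φ₂),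
            (∀ r, φ₂ r ≤ φ₁ r) →
            cycleVar (π.prod (gaussianReal 0 s)) lam f (refreshment s ω)
                (metropolizedFlow (π.prod (gaussianReal 0 s)) momentumFlip ψ φ₁ hξ.measurable
                  hψ.measurable hφ₁.measurable) ≤
              cycleVar (π.prod (gaussianReal 0 s)) lam f (refreshment s ω)
                (metropolizedFlow (π.prod (gaussianReal 0 s)) momentumFlip ψ φ₂ hξ.measurable
                  hψ.measurable hφ₂.measurable)) ∧
          (∃ hmin : IsAcceptance (fun r => min 1 r),
            ∀ (φ : ℝ≥0 → ℝ≥0) (hφ : IsAcceptance φ),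
              cycleVar (π.prod (gaussianReal 0 s)) lam f (refreshment s ω)
                  (metropolizedFlow (π.prod (gaussianReal 0 s)) momentumFlip ψ
                    (fun r => min 1 r) hξ.measurable hψ.measurable hmin.measurable) ≤
                cycleVar (π.prod (gaussianReal 0 s)) lam f (refreshment s ω)
                  (metropolizedFlow (π.prod (gaussianReal 0 s)) momentumFlip ψ φ hξ.measurable
                    hψ.measurable hφ.measurable))) ∧
    -- the Störmer-Verlet integrator is an admissible flow
    (∀ (p : ℝ → ℝ) (_ : ∀ x, 0 < p x) (_ : Differentiable ℝ p) (s : ℝ≥0) (_ : 0 < s) (t : ℝ),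
      IsTimeReversible momentumFlip (verlet (hamiltonian p s) t)) := by
  refine ⟨?_, ?_, fun p hp hd s hs t => isTimeReversible_verlet hp hd hs t⟩
  · intro E _ μ _ ξ ψ hξ hψ P _ hP f hf hfξ lam h₀ h₁
    exact ⟨fun φ hφ => cycleVarWellDefined_metropolizedFlow hξ hψ hP hf h₀ h₁ hφ,
      fun φ₁ φ₂ hφ₁ hφ₂ hle => cycleVar_metropolizedFlow_le hξ hψ hP hf hfξ h₀ h₁ hφ₁ hφ₂ hle,
      isAcceptance_min, fun φ hφ => cycleVar_metropolizedFlow_le hξ hψ hP hf hfξ h₀ h₁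
        isAcceptance_min hφ hφ.le_min_one_self⟩
  · intro π _ s _ ω _ _
    have hξ := isIsometricInvolution_momentumFlip π s
    have hP := isReversible_refreshment π s ω
    refine ⟨hξ, isMarkovKernel_refreshment s ω, hP, fun ψ hψ f hf hfξ lam h₀ h₁ => ?_⟩
    exact ⟨fun φ hφ => cycleVarWellDefined_metropolizedFlow hξ hψ hP hf h₀ h₁ hφ,
      fun φ₁ φ₂ hφ₁ hφ₂ hle => cycleVar_metropolizedFlow_le hξ hψ hP hf hfξ h₀ h₁ hφ₁ hφ₂ hle,
      isAcceptance_min, fun φ hφ => cycleVar_metropolizedFlow_le hξ hψ hP hf hfξ h₀ h₁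
        isAcceptance_min hφ hφ.le_min_one_self⟩
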